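/- Let $N=\{1,\dots,n\}$ be a set of $n\ge 1$ agents and $M=\{1,\dots,m\}$ a finite set of $m \ge 0$ indivisible chores. For each agent $i\in N$ let $c_i:2^M\to\mathbb{R}_{\ge 0}$ be an additive cost function, i.e. $c_i(S)=\sum_{j\in S}c_i(\{j\})$ for all $S\subseteq M$ (so $c_i(\emptyset)=0$). An allocation is a family $x=(x_i)_{i\in N}$ of pairwise disjoint, possibly empty, subsets of $M$ with $\bigcup_{i\in N}x_i=M$. Then there exists an allocation $x$ that is both (1) envy-free up to one chore (EF1): for all $i,i'\in N$ with $c_i(x_i)>c_i(x_{i'})$ there is a chore $j\in x_i$ such that $c_i(x_i\setminus\{j\})\le c_i(x_{i'})$; and (2) Pareto optimal (PO): there is no allocation $y$ such that $c_i(y_i)\le c_i(x_i)$ for every $i\in N$ and $c_{i'}(y_{i'})<c_{i'}(x_{i'})$ for some $i'\in N$. -/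

import Mathlib

namespace Chores

variable {N M : Type*}

/-- A set function on bundles of chores is an additive, non-negative cost function. The additivity
clause at the empty bundle says that its cost is `0`. -/
structure IsAdditiveCost (f : Finset M → ℝ) : Prop where
  nonneg : ∀ S : Finset M, 0 ≤ f S
  additive : ∀ S : Finset M, f S = ∑ j ∈ S, f {j}

/-- An (integral) allocation: the bundles `x i` are pairwise disjoint and cover all the chores.
Bundles may be empty. -/
structure IsAllocation (x : N → Finset M) : Prop where
  disjoint : ∀ i i' : N, i ≠ i' → Disjoint (x i) (x i')
  cover : ∀ j : M, ∃ i : N, j ∈ x i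

/-- Under the costs `c` and the allocation `x`, agent `i` envies agent `i'`. -/
def Envies (c : N → Finset M → ℝ) (x : N → Finset M) (i i' : N) : Prop :=
  c i (x i') < c i (x i)

/-- Envy-freeness up to one chore: any envy of `i` towards `i'` disappears after removing some
chore from the bundle of `i`. -/
def IsEF1 [DecidableEq M] (c : N → Finset M → ℝ) (x : N → Finset M) : Prop :=
  ∀ i i' : N, Envies c x i i' → ∃ j ∈ x i, c i (x i \ {j}) ≤ c i (x i')

/-- `x` is Pareto dominated by `y`: nobody has a higher cost in `y`, somebody has a lower one. -/
def ParetoDominatedBy (c : N → Finset M → ℝ) (x y : N → Finset M) : Prop :=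
  (∀ i : N, c i (y i) ≤ c i (x i)) ∧ ∃ i' : N, c i' (y i') < c i' (x i')

/-- Pareto optimality: no (integral) allocation Pareto dominates `x`. -/
def IsParetoOptimal (c : N → Finset M → ℝ) (x : N → Finset M) : Prop :=
  ∀ y : N → Finset M, IsAllocation y → ¬ ParetoDominatedBy c x y

end Chores

/-!
An allocation is encoded by the function `a` sending a chore to its owner. If positive weights `w i`
make every owner a cheapest agent for her chores under the costs `q i j = w i * c i {j}`, then `a`
minimises the weighted total cost and hence is Pareto optimal. The cost `q i j` of a chore is then
the same for all agents who are cheapest for it and can be read as its price. If, up to one chore,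
nobody's bundle is worth more in these prices than anybody else's, then `a` is EF1, because `i`
finds the bundle of `k` at least as costly as its price. So weights and a balanced cheapest
allocation are what has to be found (`exists_weights_isBalanced`).

The weights come from a fixed point argument. By the KKM lemma (`exists_mem_forall_of_facets`,
derived from Scarf's lemma `exists_dominating_rainbow`, which is a parity argument) there are
weights at which every agent pays least in some cheapest allocation, the allocation depending on
the agent: cheapest allocations and least payers always exist, and an agent of comparatively
enormous weight gets no chores (`exists_weights_forall_least`).

Now fix these weights and suppose that the graph of cheapest agents is a forest. Let `L` be the
largest forced cost of an agent, that is, the cost of the chores for which she alone is cheapest.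
The cheapest allocation in which this agent pays least gives everybody at least `L`. From there,
process the forest from its roots: an agent who pays more than `L` even after losing any one of her
chores passes chores on to agents not yet processed. She ends with forced chores and at most one
other, so she pays at most `L` up to one chore, and nobody ever drops below `L`
(`exists_atMostUpToOne`).

A cycle in the graph is a multiplicative relation between the costs, so the graph is a forest for
generic costs (`IsGeneric.isForest`). Generic costs are dense (`exists_isGeneric_near`), the weights
stay in a compact set, and being a balanced cheapest allocation is a closed condition, which settles
all positive costs. A chore of cost zero for somebody is given to such an agent.
-/

namespace Chores

/-! ### Scarf's lemma -/

section Scarf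

variable {I X : Type*}

/-- `σ` is dominating for the rankings `r i` if no point is strictly above `σ` in every
ranking: each `y` lies weakly below all of `σ` in some ranking. -/
def Dominating (r : I → X → ℕ) (σ : Finset X) : Prop :=
  ∀ y, ∃ i, ∀ x ∈ σ, r i y ≤ r i x

theorem Dominating.mono {r : I → X → ℕ} {σ τ : Finset X} (h : Dominating r σ) (hτ : τ ⊆ σ) :
    Dominating r τ := fun y => by
  obtain ⟨i, hi⟩ := h y
  exact ⟨i, fun x hx => hi x (hτ hx)⟩

variable [Fintype I] [DecidableEq I]

/-- In a dominating set one point short of full size, the map sending a ranking to the lowest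
point of the set identifies exactly one pair of rankings `i ≠ j`. -/
theorem Dominating.exists_pair {r : I → X → ℕ} (hr : ∀ i, Function.Injective (r i))
    {τ : Finset X} (hτ : Dominating r τ) (hcard : τ.card + 1 = Fintype.card I)
    (hne : τ.Nonempty) :
    ∃ m : I → X, (∀ i, m i ∈ τ) ∧ (∀ i, ∀ x ∈ τ, r i (m i) ≤ r i x) ∧
      ∃ i j, i ≠ j ∧ m i = m j ∧
        (∀ k, (k = i ∨ k = j) → ∀ x ∈ τ, ∃ l, l ≠ k ∧ m l = x) ∧
        ∀ k, (∀ a b, a ≠ k → b ≠ k → m a = m b → a = b) → k = i ∨ k = j := by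
  choose m hm hmin using fun i => Finset.exists_min_image τ (r i) hne
  have hsurj : ∀ x ∈ τ, ∃ l, m l = x := fun x hx => by
    obtain ⟨l, hl⟩ := hτ x
    exact ⟨l, hr l (le_antisymm (hmin l x hx) (hl _ (hm l)))⟩
  obtain ⟨i, -, j, -, hij, hmij⟩ := Finset.exists_ne_map_eq_of_card_lt_of_maps_to
    (s := (Finset.univ : Finset I)) (t := τ) (by rw [Finset.card_univ]; omega)
    (f := m) (fun i _ => hm i)
  refine ⟨m, hm, hmin, i, j, hij, hmij, ?_, ?_⟩
  · intro k hk x hx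
    obtain ⟨l, rfl⟩ := hsurj x hx
    by_cases hlk : l = k
    · rcases hk with rfl | rfl
      · exact ⟨j, hij.symm, by rw [hlk, hmij]⟩
      · exact ⟨i, hij, by rw [hlk, hmij]⟩
    · exact ⟨l, hlk, rfl⟩
  · intro k hk
    by_contra! hcon
    exact hij (hk i j hcon.1.symm hcon.2.symm hmij)

/-- A dominating set `τ` one point short of full size extends to a dominating set of full size in
exactly two ways, one for each ranking of the pair that shares a lowest point, provided that the
region strictly above `τ` in all the other rankings contains a point. -/
theorem Dominating.card_extensions [Fintype X] [DecidableEq X] {r : I → X → ℕ}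
    (hr : ∀ i, Function.Injective (r i)) {τ : Finset X} (hτ : Dominating r τ)
    {m : I → X} (hm : ∀ i, m i ∈ τ) (hmin : ∀ i, ∀ x ∈ τ, r i (m i) ≤ r i x)
    (hcard : τ.card + 1 = Fintype.card I) {i j : I} (hij : i ≠ j)
    (hsurj : ∀ k, (k = i ∨ k = j) → ∀ x ∈ τ, ∃ l, l ≠ k ∧ m l = x)
    (hpair : ∀ k, (∀ a b, a ≠ k → b ≠ k → m a = m b → a = b) → k = i ∨ k = j)
    (S : Finset (Finset X))
    (hS : ∀ σ, σ ∈ S ↔ Dominating r σ ∧ ∃ x, x ∉ τ ∧ σ = insert x τ) :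
    S.card = (if ∃ y, ∀ l, l ≠ i → r l (m l) < r l y then 1 else 0) +
      (if ∃ y, ∀ l, l ≠ j → r l (m l) < r l y then 1 else 0) := by
  classical
  let Mx : I → Finset X := fun k => Finset.univ.filter fun y => ∀ l, l ≠ k → r l (m l) < r l y
  -- the points that may complete `τ` on behalf of the ranking `k`
  let T : I → Finset X := fun k => (Mx k).filter fun x => ∀ y ∈ Mx k, r k y ≤ r k x
  have hT : ∀ k x, x ∈ T k ↔ (∀ l, l ≠ k → r l (m l) < r l x) ∧
      ∀ y, (∀ l, l ≠ k → r l (m l) < r l y) → r k y ≤ r k x := by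
    intro k x; simp [T, Mx]
  have hTcard : ∀ k, (T k).card = if ∃ y, ∀ l, l ≠ k → r l (m l) < r l y then 1 else 0 := by
    intro k
    split_ifs with h
    · obtain ⟨y, hy⟩ := h
      obtain ⟨x, hx, hxmax⟩ := Finset.exists_max_image (Mx k) (r k) ⟨y, by simpa [Mx] using hy⟩
      rw [Finset.card_eq_one]
      refine ⟨x, Finset.ext fun z => ?_⟩
      simp only [T, Finset.mem_filter, Finset.mem_singleton]
      constructor
      · rintro ⟨hz, hzmax⟩
        exact hr k (le_antisymm (hxmax z hz) (hzmax x hx))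
      · rintro rfl
        exact ⟨hx, hxmax⟩
    · rw [Finset.card_eq_zero, Finset.eq_empty_iff_forall_notMem]
      intro x hx
      exact h ⟨x, ((hT k x).1 hx).1⟩
  have hTτ : ∀ k, (k = i ∨ k = j) → ∀ x ∈ T k, x ∉ τ := by
    intro k hk x hx hxτ
    obtain ⟨l, hlk, rfl⟩ := hsurj k hk x hxτ
    exact lt_irrefl _ (((hT k _).1 hx).1 l hlk)
  have hdisj : Disjoint (T i) (T j) := by
    rw [Finset.disjoint_left]
    intro x hxi hxj
    obtain ⟨l, hl⟩ := hτ x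
    have h1 := hl _ (hm l)
    by_cases hli : l = i
    · have := ((hT j x).1 hxj).1 l (by rw [hli]; exact hij)
      omega
    · have := ((hT i x).1 hxi).1 l hli
      omega
  rw [← hTcard, ← hTcard, ← Finset.card_union_of_disjoint hdisj]
  symm
  refine Finset.card_bij (fun x _ => insert x τ) ?_ ?_ ?_
  · intro x hx
    obtain ⟨k, hk, hxk⟩ : ∃ k, (k = i ∨ k = j) ∧ x ∈ T k := by
      rcases Finset.mem_union.1 hx with h | h
      · exact ⟨i, Or.inl rfl, h⟩
      · exact ⟨j, Or.inr rfl, h⟩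
    refine (hS _).2 ⟨?_, x, hTτ k hk x hxk, rfl⟩
    obtain ⟨hx1, hx2⟩ := (hT k x).1 hxk
    intro y
    by_cases hy : ∀ l, l ≠ k → r l (m l) < r l y
    · have hyx := hx2 y hy
      obtain ⟨l, hl⟩ := hτ x
      have hlk : l = k := by
        by_contra hlk
        have := hx1 l hlk
        have := hl _ (hm l)
        omega
      subst hlk
      refine ⟨l, fun z hz => ?_⟩
      rcases Finset.mem_insert.1 hz with rfl | hz
      · exact hyx
      · exact hyx.trans (hl z hz)
    · push Not at hy
      obtain ⟨l, hlk, hl⟩ := hy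
      refine ⟨l, fun z hz => ?_⟩
      rcases Finset.mem_insert.1 hz with rfl | hz
      · exact hl.trans (hx1 l hlk).le
      · exact hl.trans (hmin l z hz)
  · intro x hx y hy hxy
    have hx' : x ∉ τ := by
      rcases Finset.mem_union.1 hx with h | h
      · exact hTτ i (Or.inl rfl) x h
      · exact hTτ j (Or.inr rfl) x h
    have : x ∈ insert y τ := hxy ▸ Finset.mem_insert_self x τ
    exact (Finset.mem_insert.1 this).resolve_right hx'
  · intro σ hσ
    obtain ⟨hdom, x, hxτ, rfl⟩ := (hS σ).1 hσ
    refine ⟨x, ?_, rfl⟩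
    -- the lowest points of the extended set are in bijection with the rankings
    have hne : (insert x τ).Nonempty := Finset.insert_nonempty _ _
    choose m' hm' hmin' using fun i => Finset.exists_min_image (insert x τ) (r i) hne
    have hsurj' : ∀ z ∈ insert x τ, ∃ l, m' l = z := fun z hz => by
      obtain ⟨l, hl⟩ := hdom z
      exact ⟨l, hr l (le_antisymm (hmin' l z hz) (hl _ (hm' l)))⟩
    have himg : Finset.univ.image m' = insert x τ := by
      ext z
      simp only [Finset.mem_image, Finset.mem_univ, true_and]
      exact ⟨by rintro ⟨l, rfl⟩; exact hm' l, hsurj' z⟩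
    have hinj : Function.Injective m' := by
      have := (Finset.card_image_iff (s := Finset.univ) (f := m')).1
        (by rw [himg, Finset.card_insert_of_notMem hxτ, hcard, Finset.card_univ])
      exact fun a b hab => this (by simp) (by simp) hab
    obtain ⟨k, hk⟩ := hsurj' x (Finset.mem_insert_self _ _)
    have hne' : ∀ l, l ≠ k → m' l = m l ∧ r l (m l) < r l x := by
      intro l hl
      have h1 : m' l ≠ x := fun h => hl (hinj (h.trans hk.symm))
      have h2 : m' l ∈ τ := (Finset.mem_insert.1 (hm' l)).resolve_left h1
      have h3 : m' l = m l := hr l (le_antisymm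
        (hmin' l _ (Finset.mem_insert_of_mem (hm l))) (hmin l _ h2))
      refine ⟨h3, lt_of_le_of_ne ?_ fun h => h1 (h3.trans (hr l h))⟩
      rw [← h3]; exact hmin' l x (Finset.mem_insert_self _ _)
    have hkij := hpair k fun a b ha hb hab =>
      hinj (by rw [(hne' a ha).1, (hne' b hb).1, hab])
    have hxk : x ∈ T k := by
      refine (hT k x).2 ⟨fun l hl => (hne' l hl).2, fun y hy => ?_⟩
      obtain ⟨l, hl⟩ := hdom y
      have hlk : l = k := by
        by_contra hlk
        have := hy l hlk
        have := hl _ (Finset.mem_insert_of_mem (hm l))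
        omega
      subst hlk
      exact hl x (Finset.mem_insert_self _ _)
    rcases hkij with rfl | rfl
    · exact Finset.mem_union_left _ hxk
    · exact Finset.mem_union_right _ hxk

/-- A full-size set that is not rainbow has an even number of points whose removal leaves exactly
the colours other than `i₀`. -/
theorem even_card_rainbow_facets [DecidableEq X] {c : X → I} {i₀ : I} {σ : Finset X}
    (hcard : σ.card = Fintype.card I) (hσ : σ.image c ≠ Finset.univ) :
    Even (σ.filter fun x => (σ.erase x).image c = Finset.univ.erase i₀).card := by
  classical
  rcases Finset.eq_empty_or_nonempty
    (σ.filter fun x => (σ.erase x).image c = Finset.univ.erase i₀) with h | ⟨x, hx⟩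
  · rw [h]; simp
  · obtain ⟨hxσ, hx⟩ := Finset.mem_filter.1 hx
    have hpos : 0 < Fintype.card I := Fintype.card_pos_iff.2 ⟨i₀⟩
    have hinj : Set.InjOn c (σ.erase x) := by
      rw [← Finset.card_image_iff, hx, Finset.card_erase_of_mem hxσ,
        Finset.card_erase_of_mem (Finset.mem_univ _), hcard, Finset.card_univ]
    have hcx : c x ≠ i₀ := by
      intro h
      apply hσ
      rw [← Finset.insert_erase hxσ, Finset.image_insert, hx, h,
        Finset.insert_erase (Finset.mem_univ _)]
    have : c x ∈ (σ.erase x).image c := by rw [hx]; simp [hcx]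
    obtain ⟨x', hx', hcx'⟩ := Finset.mem_image.1 this
    obtain ⟨hne, hx'σ⟩ := Finset.mem_erase.1 hx'
    suffices h : (σ.filter fun x => (σ.erase x).image c = Finset.univ.erase i₀) = {x, x'} by
      rw [h, Finset.card_pair hne.symm]; exact even_two
    ext z
    simp only [Finset.mem_filter, Finset.mem_insert, Finset.mem_singleton]
    constructor
    · rintro ⟨hz, hz'⟩
      by_contra! hcon
      have hzinj : Set.InjOn c (σ.erase z) := by
        rw [← Finset.card_image_iff, hz', Finset.card_erase_of_mem hz,
          Finset.card_erase_of_mem (Finset.mem_univ _), hcard, Finset.card_univ]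
      exact hne (hzinj (by simp [hx'σ, hcon.2.symm]) (by simp [hxσ, hcon.1.symm]) hcx')
    · rintro (rfl | rfl)
      · exact ⟨hxσ, hx⟩
      · refine ⟨hx'σ, ?_⟩
        rw [← hx]
        ext k
        simp only [Finset.mem_image, Finset.mem_erase]
        constructor
        · rintro ⟨y, ⟨hy1, hy2⟩, rfl⟩
          by_cases hyx : y = x
          · subst hyx; exact ⟨z, ⟨hne, hx'σ⟩, hcx'⟩
          · exact ⟨y, ⟨hyx, hy2⟩, rfl⟩
        · rintro ⟨y, ⟨hy1, hy2⟩, rfl⟩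
          by_cases hyx : y = z
          · subst hyx; exact ⟨x, ⟨hne.symm, hxσ⟩, hcx'.symm⟩
          · exact ⟨y, ⟨hyx, hy2⟩, rfl⟩

/-- **Scarf's lemma.** `s i` is the lowest point of the ranking `i`, and it lies above every point
outside the range of `s` in the other rankings. If `s i` has colour `i`, there is a dominating set
that contains each colour exactly once. -/
theorem exists_dominating_rainbow [Fintype X] [DecidableEq X] [Nonempty I] {r : I → X → ℕ}
    (hr : ∀ i, Function.Injective (r i)) (s : I → X) (hs : ∀ i x, r i (s i) ≤ r i x)
    (hs' : ∀ i k x, k ≠ i → x ∉ Set.range s → r i x < r i (s k)) (hX : ∃ x, x ∉ Set.range s)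
    (c : X → I) (hc : ∀ i, c (s i) = i) :
    ∃ σ : Finset X, σ.card = Fintype.card I ∧ σ.image c = Finset.univ ∧ Dominating r σ := by
  classical
  by_contra! hcon
  obtain ⟨i₀⟩ := ‹Nonempty I›
  have hsinj : Function.Injective s := fun a b hab => by rw [← hc a, hab, hc]
  have hpos : 0 < Fintype.card I := Fintype.card_pos_iff.2 ⟨i₀⟩
  let R : Finset (Finset X) :=
    Finset.univ.filter fun σ => σ.card = Fintype.card I ∧ Dominating r σ
  let D : Finset (Finset X) := Finset.univ.filter fun τ =>
    τ.card + 1 = Fintype.card I ∧ Dominating r τ ∧ τ.image c = Finset.univ.erase i₀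
  let inc : Finset X → Finset X → Prop := fun σ τ => ∃ x, x ∉ τ ∧ σ = insert x τ
  have hdc := Finset.sum_card_bipartiteAbove_eq_sum_card_bipartiteBelow (s := R) (t := D) inc
  have hR : Even (∑ σ ∈ R, (D.bipartiteAbove inc σ).card) := by
    refine Finset.even_sum _ fun σ hσ => ?_
    obtain ⟨hσc, hσd⟩ := (Finset.mem_filter.1 hσ).2
    have := even_card_rainbow_facets (c := c) (i₀ := i₀) hσc fun h => hcon σ hσc h hσd
    have heq : (σ.filter fun x => (σ.erase x).image c = Finset.univ.erase i₀).card =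
        (D.bipartiteAbove inc σ).card := ?_
    · rwa [← heq]
    refine Finset.card_bij (fun x _ => σ.erase x) ?_ ?_ ?_
    · intro x hx
      obtain ⟨hx, hx'⟩ := Finset.mem_filter.1 hx
      refine Finset.mem_filter.2 ⟨Finset.mem_filter.2 ⟨Finset.mem_univ _, ?_,
        hσd.mono (Finset.erase_subset _ _), hx'⟩, x, Finset.notMem_erase _ _,
        (Finset.insert_erase hx).symm⟩
      rw [Finset.card_erase_of_mem hx]; omega
    · intro x hx y hy hxy
      by_contra hne
      have : x ∈ σ.erase y := Finset.mem_erase.2 ⟨hne, (Finset.mem_filter.1 hx).1⟩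
      rw [← hxy] at this
      exact Finset.notMem_erase _ _ this
    · intro τ hτ
      obtain ⟨hτD, x, hx, rfl⟩ := Finset.mem_filter.1 hτ
      refine ⟨x, Finset.mem_filter.2 ⟨Finset.mem_insert_self _ _, ?_⟩, Finset.erase_insert hx⟩
      rw [Finset.erase_insert hx]
      exact (Finset.mem_filter.1 hτD).2.2.2
  -- the only facet of this kind that does not separate two full-size dominating sets
  let τ₀ : Finset X := (Finset.univ.erase i₀).image s
  have hτ₀mem : ∀ k, s k ∈ τ₀ ↔ k ≠ i₀ := by
    intro k; simp only [τ₀, Finset.mem_image, Finset.mem_erase, Finset.mem_univ, and_true]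
    exact ⟨by rintro ⟨a, ha, hak⟩; exact hsinj hak ▸ ha, fun h => ⟨k, h, rfl⟩⟩
  have hτ₀D : τ₀ ∈ D := by
    refine Finset.mem_filter.2 ⟨Finset.mem_univ _, ?_, ?_, ?_⟩
    · rw [Finset.card_image_of_injective _ hsinj, Finset.card_erase_of_mem (Finset.mem_univ _),
        Finset.card_univ]
      omega
    · intro y
      by_cases hy : y ∈ Set.range s
      · obtain ⟨k, rfl⟩ := hy
        exact ⟨k, fun x _ => hs k x⟩
      · refine ⟨i₀, fun x hx => ?_⟩
        obtain ⟨k, hk, rfl⟩ := Finset.mem_image.1 hx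
        exact (hs' i₀ k y (Finset.mem_erase.1 hk).1 hy).le
    · rw [Finset.image_image]
      have : c ∘ s = id := funext hc
      rw [this, Finset.image_id]
  have hDeven : ∀ τ ∈ D, τ ≠ τ₀ → Even (R.bipartiteBelow inc τ).card := by
    intro τ hτ hne
    obtain ⟨hτc, hτd, hτcol⟩ := (Finset.mem_filter.1 hτ).2
    -- some point of `τ` is not of the form `s k`
    have hex : ∃ x ∈ τ, x ∉ Set.range s := by
      by_contra! hall
      apply hne
      refine Finset.eq_of_subset_of_card_le (fun x hx => ?_) ?_
      · obtain ⟨k, rfl⟩ := hall x hx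
        have : c (s k) ∈ τ.image c := Finset.mem_image_of_mem _ hx
        rw [hτcol, hc] at this
        exact (hτ₀mem k).2 (Finset.mem_erase.1 this).1
      · have := (Finset.mem_filter.1 hτ₀D).2.1
        omega
    obtain ⟨x, hx, hxs⟩ := hex
    obtain ⟨m, hm, hmin, i, j, hij, hmij, hsurj, hpair⟩ :=
      hτd.exists_pair hr hτc ⟨x, hx⟩
    have key := hτd.card_extensions hr hm hmin hτc hij hsurj hpair (R.bipartiteBelow inc τ) (by
      intro σ
      simp only [Finset.mem_bipartiteBelow, R, Finset.mem_filter, Finset.mem_univ, true_and, inc]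
      refine ⟨fun h => ⟨h.1.2, h.2⟩, fun h => ⟨⟨?_, h.1⟩, h.2⟩⟩
      obtain ⟨-, z, hz, rfl⟩ := h
      rw [Finset.card_insert_of_notMem hz, hτc])
    have habove : ∀ k, ∃ y, ∀ l, l ≠ k → r l (m l) < r l y := fun k =>
      ⟨s k, fun l hl => (hmin l x hx).trans_lt (hs' l k x hl.symm hxs)⟩
    rw [key, if_pos (habove i), if_pos (habove j)]
    exact even_two
  have hDodd : (R.bipartiteBelow inc τ₀).card = 1 := by
    obtain ⟨x₁, hx₁⟩ := hX
    obtain ⟨-, hτc, hτd, hτcol⟩ := Finset.mem_filter.1 hτ₀D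
    obtain ⟨x₀, hx₀, hmax⟩ := Finset.exists_max_image
      (Finset.univ.filter fun x => x ∉ Set.range s) (r i₀) ⟨x₁, by simpa using hx₁⟩
    have hx₀s : x₀ ∉ Set.range s := (Finset.mem_filter.1 hx₀).2
    have hx₀τ : x₀ ∉ τ₀ := fun h => by
      obtain ⟨k, -, rfl⟩ := Finset.mem_image.1 h
      exact hx₀s ⟨k, rfl⟩
    rw [Finset.card_eq_one]
    refine ⟨insert x₀ τ₀, Finset.ext fun σ => ?_⟩
    simp only [Finset.mem_bipartiteBelow, R, Finset.mem_filter, Finset.mem_univ, true_and, inc,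
      Finset.mem_singleton]
    constructor
    · rintro ⟨⟨hσc, hσd⟩, x, hx, rfl⟩
      have hxs : x ∉ Set.range s := by
        rintro ⟨k, rfl⟩
        have hk : k = i₀ := by
          by_contra h; exact hx ((hτ₀mem k).2 h)
        subst hk
        obtain ⟨l, hl⟩ := hσd x₀
        have h1 : s l ∈ insert (s k) τ₀ := by
          by_cases hlk : l = k
          · simp [hlk]
          · exact Finset.mem_insert_of_mem ((hτ₀mem l).2 hlk)
        have h2 := hl _ h1
        exact hx₀s ⟨l, hr l (le_antisymm (hs l x₀) h2)⟩
      obtain ⟨l, hl⟩ := hσd x₀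
      have hli : l = i₀ := by
        by_contra h
        have h2 := hl _ (Finset.mem_insert_of_mem ((hτ₀mem l).2 h))
        exact hx₀s ⟨l, hr l (le_antisymm (hs l x₀) h2)⟩
      subst hli
      rw [hr l (le_antisymm (hmax x (by simpa using hxs)) (hl x (Finset.mem_insert_self _ _)))]
    · rintro rfl
      refine ⟨⟨by rw [Finset.card_insert_of_notMem hx₀τ, hτc], fun y => ?_⟩, x₀, hx₀τ, rfl⟩
      by_cases hy : y ∈ Set.range s
      · obtain ⟨k, rfl⟩ := hy
        exact ⟨k, fun x _ => hs k x⟩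
      · refine ⟨i₀, fun x hx => ?_⟩
        rcases Finset.mem_insert.1 hx with rfl | hx
        · exact hmax y (by simpa using hy)
        · obtain ⟨k, hk, rfl⟩ := Finset.mem_image.1 hx
          exact (hs' i₀ k y (Finset.mem_erase.1 hk).1 hy).le
  rw [hdc, ← Finset.add_sum_erase _ _ hτ₀D, hDodd] at hR
  have : Even (∑ τ ∈ D.erase τ₀, (R.bipartiteBelow inc τ).card) :=
    Finset.even_sum _ fun τ hτ => hDeven τ (Finset.mem_erase.1 hτ).2 (Finset.mem_erase.1 hτ).1
  rw [Nat.even_add] at hR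
  exact absurd (hR.2 this) (by decide)

end Scarf

/-! ### The KKM lemma -/

section KKM

variable {I : Type*} [Fintype I] [DecidableEq I] [Nonempty I]

/-- A discrete KKM lemma: if the points of the grid `∑ v = K` with a small coordinate are coloured
by a smallest coordinate, then there are grid points of all colours close to one another. -/
theorem exists_close_rainbow (K : ℕ) (hK : Fintype.card I * Fintype.card I ≤ K)
    (col : (I → ℕ) → I)
    (hcol : ∀ v : I → ℕ, (∃ i, v i < Fintype.card I) → ∀ k, v (col v) ≤ v k) :
    ∃ x : I → I → ℕ, (∀ i, ∑ k, x i k = K) ∧ (∀ i, col (x i) = i) ∧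
      ∀ i i' k, x i k ≤ x i' k + Fintype.card I := by
  classical
  let T := {v : I → ℕ // v ∈ Finset.piAntidiag Finset.univ K}
  have : Fintype T := inferInstanceAs (Fintype (Finset.piAntidiag (Finset.univ : Finset I) K))
  have hTmem : ∀ v : I → ℕ, v ∈ Finset.piAntidiag Finset.univ K ↔ ∑ k, v k = K := by
    intro v; simp [Finset.mem_piAntidiag]
  let B := Fintype.card T
  let e : T ≃ Fin B := Fintype.equivFin T
  let eI : I ≃ Fin (Fintype.card I) := Fintype.equivFin I
  -- ties between equal coordinates are broken by an arbitrary enumeration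
  let f : I → T → ℕ := fun i v => v.1 i * B + e v
  have hf : ∀ i (v w : T), f i v ≤ f i w → v.1 i ≤ w.1 i := by
    intro i v w h
    by_contra! hlt
    have h1 : (w.1 i + 1) * B ≤ v.1 i * B := Nat.mul_le_mul_right _ hlt
    have h2 := (e w).2
    simp only [f] at h
    rw [add_mul] at h1
    omega
  have hfinj : ∀ i, Function.Injective (f i) := by
    intro i v w h
    have h1 : v.1 i = w.1 i := le_antisymm (hf i v w h.le) (hf i w v h.ge)
    simp only [f, h1] at h
    exact e.injective (Fin.ext (by omega))
  have hfB : ∀ i v, f i v < (K + 1) * B := by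
    intro i v
    have h1 : v.1 i ≤ K := by
      have h0 := (hTmem _).1 v.2
      have := Finset.single_le_sum (f := v.1) (fun _ _ => Nat.zero_le _) (Finset.mem_univ i)
      omega
    have h2 := Nat.mul_le_mul_right B h1
    have h3 := (e v).2
    simp only [f]
    rw [add_mul]
    omega
  let r : I → T ⊕ I → ℕ := fun i => Sum.elim (fun v => f i v + 1)
    (fun k => if k = i then 0 else (K + 1) * B + 1 + eI k)
  have hr : ∀ i, Function.Injective (r i) := by
    intro i a b h
    rcases a with v | k <;> rcases b with w | l <;> simp only [r, Sum.elim_inl, Sum.elim_inr] at h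
    · rw [hfinj i (Nat.succ_injective h)]
    · have := hfB i v
      split_ifs at h
      omega
    · have := hfB i w
      split_ifs at h
      omega
    · split_ifs at h with h1 h2 h2
      · rw [h1, h2]
      · omega
      · omega
      · exact congrArg Sum.inr (eI.injective (Fin.ext (by omega)))
  let i₀ : I := Classical.arbitrary I
  have hT0 : (Pi.single i₀ K : I → ℕ) ∈ Finset.piAntidiag Finset.univ K := by
    rw [hTmem]; simp
  obtain ⟨σ, -, himg, hdom⟩ := exists_dominating_rainbow hr (Sum.inr : I → T ⊕ I)
    (by intro i x; simp [r])
    (by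
      intro i k x hk hx
      rcases x with v | l
      · have := hfB i v
        simp only [r, Sum.elim_inl, Sum.elim_inr, if_neg hk]
        omega
      · exact absurd ⟨l, rfl⟩ hx)
    ⟨Sum.inl ⟨_, hT0⟩, by simp⟩
    (Sum.elim (fun v => col v.1) id) (by simp)
  let C : Finset I := Finset.univ.filter fun i => Sum.inr i ∉ σ
  have hC : ∀ i, i ∈ C ↔ Sum.inr i ∉ σ := by intro i; simp [C]
  let S : Finset T := Finset.univ.filter fun v => Sum.inl v ∈ σ
  have hS : ∀ v, v ∈ S ↔ Sum.inl v ∈ σ := by intro i; simp [S]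
  have hcolC : ∀ i ∈ C, ∃ v ∈ S, col v.1 = i := by
    intro i hi
    have : i ∈ σ.image (Sum.elim (fun v : T => col v.1) id) := by rw [himg]; simp
    obtain ⟨x, hx, hxi⟩ := Finset.mem_image.1 this
    rcases x with v | k
    · exact ⟨v, (hS v).2 hx, hxi⟩
    · simp only [Sum.elim_inr, id] at hxi
      subst hxi
      exact absurd hx ((hC _).1 hi)
  have hdomT : ∀ y : T, ∃ i ∈ C, ∀ v ∈ S, y.1 i ≤ v.1 i := by
    intro y
    obtain ⟨i, hi⟩ := hdom (Sum.inl y)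
    refine ⟨i, (hC i).2 fun h => ?_, fun v hv => hf i y v ?_⟩
    · have := hi _ h
      simp [r] at this
    · have := hi _ ((hS v).1 hv)
      simpa [r] using this
  obtain ⟨c₀, hc₀, -⟩ := hdomT ⟨_, hT0⟩
  have hSne : S.Nonempty := by
    obtain ⟨v, hv, -⟩ := hcolC c₀ hc₀
    exact ⟨v, hv⟩
  choose μ hμ hμmin using fun i => Finset.exists_min_image S (fun v => v.1 i) hSne
  let m : I → ℕ := fun i => (μ i).1 i
  have hmle : ∀ i, ∀ v ∈ S, m i ≤ v.1 i := hμmin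
  have hbig : K < ∑ i ∈ C, (m i + 1) := by
    by_contra! hle
    -- a grid point strictly above all the minima in the coordinates of `C`
    let y : I → ℕ := fun i => (if i ∈ C then m i + 1 else 0) +
      if i = c₀ then K - ∑ i ∈ C, (m i + 1) else 0
    have hy : ∑ i, y i = K := by
      simp only [y, Finset.sum_add_distrib, Finset.sum_ite_mem, Finset.univ_inter,
        Finset.sum_ite_eq', Finset.mem_univ, if_true]
      simp only [Finset.sum_add_distrib] at hle
      omega
    obtain ⟨i, hi, hle'⟩ := hdomT ⟨y, (hTmem y).2 hy⟩
    have := hle' _ (hμ i)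
    simp only [y, if_pos hi] at this
    simp only [m] at this
    omega
  have hCcard : C.card ≤ Fintype.card I := Finset.card_le_univ _
  rw [Finset.sum_add_distrib, Finset.sum_const, smul_eq_mul, mul_one] at hbig
  have hsumC : ∀ v ∈ S, ∀ i ∉ C, ∑ k ∈ C, m k + v.1 i ≤ K := by
    intro v hv i hi
    calc ∑ k ∈ C, m k + v.1 i ≤ ∑ k ∈ C, v.1 k + v.1 i := by
          gcongr with k; exact hmle k v hv
      _ = ∑ k ∈ insert i C, v.1 k := by rw [Finset.sum_insert hi, add_comm]
      _ ≤ ∑ k, v.1 k := Finset.sum_le_sum_of_subset (Finset.subset_univ _)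
      _ = K := (hTmem _).1 v.2
  have hCuniv : ∀ i, i ∈ C := by
    by_contra! hex
    obtain ⟨i, hi⟩ := hex
    have hm : ∀ k ∈ C, m k + 1 ≤ Fintype.card I := by
      intro k hk
      obtain ⟨v, hv, rfl⟩ := hcolC k hk
      have h1 := hsumC v hv i hi
      have h2 := hcol v.1 ⟨i, by omega⟩ i
      have h3 := hmle (col v.1) v hv
      omega
    have h1 := Finset.sum_le_card_nsmul C (fun k => m k + 1) _ hm
    rw [Finset.sum_add_distrib, Finset.sum_const, smul_eq_mul, mul_one, smul_eq_mul] at h1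
    have h2 := Nat.mul_le_mul_right (Fintype.card I) hCcard
    omega
  have hCeq : C = Finset.univ := Finset.eq_univ_iff_forall.2 hCuniv
  rw [hCeq, Finset.card_univ] at hbig
  have hup : ∀ v ∈ S, ∀ k, v.1 k ≤ m k + Fintype.card I := by
    intro v hv k
    have h1 : ∑ l ∈ Finset.univ.erase k, m l ≤ ∑ l ∈ Finset.univ.erase k, v.1 l :=
      Finset.sum_le_sum fun l _ => hmle l v hv
    have h2 := Finset.add_sum_erase Finset.univ m (Finset.mem_univ k)
    have h3 := Finset.add_sum_erase Finset.univ v.1 (Finset.mem_univ k)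
    have h4 := (hTmem _).1 v.2
    omega
  choose x hx hxcol using fun i => hcolC i (hCuniv i)
  refine ⟨fun i => (x i).1, fun i => (hTmem _).1 (x i).2, hxcol, fun i i' k => ?_⟩
  exact (hup _ (hx i) k).trans (Nat.add_le_add_right (hmle k _ (hx i')) _)

/-- **KKM lemma**, in the form with facets: if closed sets `F i` cover the standard simplex and
`F i` contains the facet `t i = 0`, then the sets have a common point in the simplex. -/
theorem exists_mem_forall_of_facets (F : I → Set (I → ℝ)) (hF : ∀ i, IsClosed (F i))
    (hcover : ∀ t ∈ stdSimplex ℝ I, ∃ i, t ∈ F i)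
    (hfacet : ∀ t ∈ stdSimplex ℝ I, ∀ i, t i = 0 → t ∈ F i) :
    ∃ t ∈ stdSimplex ℝ I, ∀ i, t ∈ F i := by
  classical
  let n := Fintype.card I
  let D : ℕ → ℕ := fun K => n * n + K + 1
  have hD : ∀ K, (0 : ℝ) < D K := fun K => by positivity
  let p : ℕ → (I → ℕ) → I → ℝ := fun K v k => (v k : ℝ) / D K
  have hp : ∀ K v, ∑ k, v k = D K → p K v ∈ stdSimplex ℝ I := by
    intro K v hv
    refine ⟨fun k => by positivity, ?_⟩
    simp only [p]
    rw [← Finset.sum_div, ← Nat.cast_sum, hv, div_self (hD K).ne']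
  choose am ham using fun v : I → ℕ => Finite.exists_min v
  have hcolex : ∀ K v, ∃ i, ((∃ k, v k < n) → ∀ k, v i ≤ v k) ∧
      (∑ k, v k = D K → p K v ∈ F i ∨ v i ≤ n) := by
    intro K v
    by_cases h : ∃ k, v k < n
    · obtain ⟨k, hk⟩ := h
      exact ⟨am v, fun _ => ham v, fun _ => Or.inr ((ham v k).trans hk.le)⟩
    · by_cases hv : ∑ k, v k = D K
      · obtain ⟨i, hi⟩ := hcover _ (hp K v hv)
        exact ⟨i, fun h' => absurd h' h, fun _ => Or.inl hi⟩
      · exact ⟨am v, fun h' => absurd h' h, fun h' => absurd h' hv⟩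
  choose col hcol1 hcol2 using hcolex
  choose x hxsum hxcol hxclose using fun K =>
    exists_close_rainbow (D K) (by simp only [D, n]; omega) (col K) (hcol1 K)
  let i₀ : I := Classical.arbitrary I
  obtain ⟨t, ht, φ, hφ, hlim⟩ := (isCompact_stdSimplex ℝ I).tendsto_subseq
    fun K => hp K _ (hxsum K i₀)
  have hsmall : Filter.Tendsto (fun K => (n : ℝ) / D (φ K)) Filter.atTop (nhds 0) := by
    refine Filter.Tendsto.div_atTop tendsto_const_nhds ?_
    refine tendsto_natCast_atTop_atTop.comp (Filter.tendsto_atTop_mono (fun K => ?_)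
      hφ.tendsto_atTop)
    simp only [D]; omega
  have hlimi : ∀ i, Filter.Tendsto (fun K => p (φ K) (x (φ K) i)) Filter.atTop (nhds t) := by
    intro i
    rw [tendsto_pi_nhds] at hlim ⊢
    intro k
    have hlo : Filter.Tendsto (fun K => p (φ K) (x (φ K) i₀) k - (n : ℝ) / D (φ K))
        Filter.atTop (nhds (t k)) := by simpa using (hlim k).sub hsmall
    have hhi : Filter.Tendsto (fun K => p (φ K) (x (φ K) i₀) k + (n : ℝ) / D (φ K))
        Filter.atTop (nhds (t k)) := by simpa using (hlim k).add hsmall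
    refine tendsto_of_tendsto_of_tendsto_of_le_of_le hlo hhi (fun K => ?_) (fun K => ?_)
    · simp only [p]
      rw [← sub_div]
      gcongr
      rw [sub_le_iff_le_add]
      exact_mod_cast hxclose (φ K) i₀ i k
    · simp only [p]
      rw [← add_div]
      gcongr
      exact_mod_cast hxclose (φ K) i i₀ k
  refine ⟨t, ht, fun i => ?_⟩
  by_contra hti
  have hpos : 0 < t i := lt_of_le_of_ne (ht.1 i) fun h => hti (hfacet t ht i h.symm)
  have h1 : ∀ᶠ K in Filter.atTop, p (φ K) (x (φ K) i) ∉ F i :=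
    (hlimi i).eventually ((hF i).isOpen_compl.mem_nhds hti)
  have h2 : ∀ᶠ K in Filter.atTop, (n : ℝ) / D (φ K) < p (φ K) (x (φ K) i) i :=
    hsmall.eventually_lt ((tendsto_pi_nhds.1 (hlimi i)) i) hpos
  obtain ⟨K, hK1, hK2⟩ := (h1.and h2).exists
  have h3 := hcol2 (φ K) (x (φ K) i) (hxsum _ i)
  rw [hxcol] at h3
  rcases h3 with h3 | h3
  · exact hK1 h3
  · refine absurd hK2 (not_lt.2 ?_)
    simp only [p]
    gcongr

end KKM

/-! ### Rounding at fixed weights -/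

section Rounding

variable {N M : Type*}

/-- Agent `i` is among the cheapest agents for the chore `j` under the costs `q`. -/
def Cheapest (q : N → M → ℝ) (i : N) (j : M) : Prop := ∀ k, q i j ≤ q k j

/-- Every chore goes to one of the agents who are cheapest for it. An allocation is encoded by the
function that sends a chore to its owner. -/
def IsCheapest (q : N → M → ℝ) (a : M → N) : Prop := ∀ j, Cheapest q (a j) j

/-- The cost of agent `i` for her own bundle. -/
def ownCost [Fintype M] [DecidableEq N] (q : N → M → ℝ) (a : M → N) (i : N) : ℝ :=
  ∑ j, if a j = i then q i j else 0

/-- Up to the removal of one of her chores, agent `i` pays at most `L`. -/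
def AtMostUpToOne [Fintype M] [DecidableEq N] (q : N → M → ℝ) (a : M → N) (L : ℝ) (i : N) : Prop :=
  ownCost q a i ≤ L ∨ ∃ j, a j = i ∧ ownCost q a i - q i j ≤ L

/-- Besides `i`, another agent of `A` is cheapest for `j`. -/
def SharedWithin (q : N → M → ℝ) (A : Finset N) (i : N) (j : M) : Prop :=
  Cheapest q i j ∧ ∃ k ∈ A, k ≠ i ∧ Cheapest q k j

/-- The bipartite graph that joins a chore to the agents who are cheapest for it is a forest, in
the form needed here: every nonempty set of agents has a member who shares at most one chore with
the other members. -/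
def IsForest (q : N → M → ℝ) : Prop :=
  ∀ A : Finset N, A.Nonempty → ∃ i ∈ A, ∀ j j', SharedWithin q A i j → SharedWithin q A i j' → j = j'

open Classical in
/-- The cost to `i` of the chores for which nobody else is cheapest, and which she has to do. -/
noncomputable def forcedCost [Fintype M] (q : N → M → ℝ) (i : N) : ℝ :=
  ∑ j, if Cheapest q i j ∧ ∀ k, Cheapest q k j → k = i then q i j else 0

theorem IsCheapest.update [DecidableEq M] {q : N → M → ℝ} {a : M → N} (ha : IsCheapest q a)
    {j : M} {k : N} (hk : Cheapest q k j) : IsCheapest q (Function.update a j k) := by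
  intro j'
  by_cases h : j' = j
  · subst h; simpa using hk
  · simpa [h] using ha j'

variable [Fintype M] [DecidableEq N] [DecidableEq M]

theorem ownCost_update_of_ne (q : N → M → ℝ) (a : M → N) {j : M} {k l : N} (hl : l ≠ a j)
    (hlk : l ≠ k) : ownCost q (Function.update a j k) l = ownCost q a l := by
  refine Finset.sum_congr rfl fun j' _ => ?_
  by_cases h : j' = j
  · subst h; simp [hl.symm, hlk.symm]
  · simp [h]

theorem ownCost_update_self (q : N → M → ℝ) (a : M → N) {j : M} {k : N} (hk : k ≠ a j) :
    ownCost q (Function.update a j k) k = ownCost q a k + q k j := by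
  simp only [ownCost]
  rw [← Finset.add_sum_erase _ _ (Finset.mem_univ j),
    ← Finset.add_sum_erase _ (fun j => if a j = k then q k j else 0) (Finset.mem_univ j)]
  have : ∑ x ∈ Finset.univ.erase j, (if Function.update a j k x = k then q k x else 0) =
      ∑ x ∈ Finset.univ.erase j, if a x = k then q k x else 0 :=
    Finset.sum_congr rfl fun x hx => by simp [Finset.ne_of_mem_erase hx]
  simp [this, hk.symm, add_comm]

theorem ownCost_update_owner (q : N → M → ℝ) (a : M → N) {j : M} {k : N} (hk : k ≠ a j) :
    ownCost q (Function.update a j k) (a j) = ownCost q a (a j) - q (a j) j := by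
  simp only [ownCost]
  rw [← Finset.add_sum_erase _ _ (Finset.mem_univ j),
    ← Finset.add_sum_erase _ (fun x => if a x = a j then q (a j) x else 0) (Finset.mem_univ j)]
  have : ∑ x ∈ Finset.univ.erase j, (if Function.update a j k x = a j then q (a j) x else 0) =
      ∑ x ∈ Finset.univ.erase j, if a x = a j then q (a j) x else 0 :=
    Finset.sum_congr rfl fun x hx => by simp [Finset.ne_of_mem_erase hx]
  simp [this, hk]

/-- If `i` can neither pass on a chore outside `A` nor share two chores within `A`, then without
one chore she pays at most her forced cost. -/
theorem atMostUpToOne_of_stuck {q : N → M → ℝ} (hq : ∀ i j, 0 ≤ q i j) {a : M → N}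
    (ha : IsCheapest q a) {A : Finset N} {i : N}
    (hi : ∀ j j', SharedWithin q A i j → SharedWithin q A i j' → j = j')
    (hstuck : ∀ j, a j = i → ∀ k, Cheapest q k j → k ∈ A) {L : ℝ} (hL : forcedCost q i ≤ L) :
    AtMostUpToOne q a L i := by
  classical
  have hheld : ∀ j, a j = i →
      (Cheapest q i j ∧ ∀ k, Cheapest q k j → k = i) ∨ SharedWithin q A i j := by
    intro j hj
    have h1 : Cheapest q i j := hj ▸ ha j
    by_cases h : ∀ k, Cheapest q k j → k = i
    · exact Or.inl ⟨h1, h⟩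
    · push Not at h
      obtain ⟨k, hk, hki⟩ := h
      exact Or.inr ⟨h1, k, hstuck j hj k hk, hki, hk⟩
  by_cases hex : ∃ j₀, a j₀ = i ∧ SharedWithin q A i j₀
  · obtain ⟨j₀, hj₀, hs⟩ := hex
    refine Or.inr ⟨j₀, hj₀, ?_⟩
    suffices h : ownCost q a i ≤ forcedCost q i + q i j₀ by linarith
    have : q i j₀ = ∑ j, if j = j₀ then q i j else 0 := by simp
    rw [this]
    simp only [ownCost, forcedCost]
    rw [← Finset.sum_add_distrib]
    refine Finset.sum_le_sum fun j _ => ?_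
    by_cases h : a j = i
    · rw [if_pos h]
      rcases hheld j h with hf | hs'
      · rw [if_pos hf]
        split_ifs
        · linarith [hq i j]
        · linarith
      · rw [if_pos (hi _ _ hs' hs)]
        split_ifs
        · linarith [hq i j]
        · linarith
    · rw [if_neg h]
      have := hq i j
      split_ifs <;> linarith
  · push Not at hex
    refine Or.inl (le_trans (Finset.sum_le_sum fun j _ => ?_) hL)
    by_cases h : a j = i
    · rw [if_pos h, if_pos ((hheld j h).resolve_right (hex j h))]
    · rw [if_neg h]
      have := hq i j
      split_ifs <;> linarith

/-- If the graph is a forest and no forced cost exceeds `L`, a cheapest allocation in which everyone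
pays at least `L` can be turned into one in which everyone, moreover, pays at most `L` up to one
chore. -/
theorem exists_atMostUpToOne [Fintype N] {q : N → M → ℝ} (hq : ∀ i j, 0 ≤ q i j)
    (hforest : IsForest q) {L : ℝ} (hL : ∀ i, forcedCost q i ≤ L) {a₀ : M → N}
    (ha₀ : IsCheapest q a₀) (hLa₀ : ∀ i, L ≤ ownCost q a₀ i) :
    ∃ a, IsCheapest q a ∧ (∀ i, L ≤ ownCost q a i) ∧ ∀ i, AtMostUpToOne q a L i := by
  classical
  suffices h : ∀ A : Finset N, ∃ a, IsCheapest q a ∧ (∀ i, L ≤ ownCost q a i) ∧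
      ∀ i ∈ A, AtMostUpToOne q a L i by
    simpa using h Finset.univ
  intro A
  induction A using Finset.strongInduction with
  | H A ih =>
    rcases A.eq_empty_or_nonempty with rfl | hA
    · exact ⟨a₀, ha₀, hLa₀, by simp⟩
    obtain ⟨i, hiA, hi⟩ := hforest A hA
    obtain ⟨a₁, h₁⟩ := ih _ (Finset.erase_ssubset hiA)
    -- a leaf `i` of the forest on `A` sheds chores to agents outside `A` as long as she can
    obtain ⟨a, ha, hamin⟩ := Finset.exists_min_image
      (Finset.univ.filter fun a : M → N => IsCheapest q a ∧ (∀ i, L ≤ ownCost q a i) ∧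
        ∀ k ∈ A.erase i, AtMostUpToOne q a L k)
      (fun a => (Finset.univ.filter fun j => a j = i).card) ⟨a₁, by simpa using h₁⟩
    obtain ⟨hac, haL, haA⟩ := (Finset.mem_filter.1 ha).2
    refine ⟨a, hac, haL, fun l hl => ?_⟩
    by_cases hli : l ≠ i
    · exact haA l (Finset.mem_erase.2 ⟨hli, hl⟩)
    rw [not_not.1 hli]
    by_cases hstuck : ∀ j, a j = i → ∀ k, Cheapest q k j → k ∈ A
    · exact atMostUpToOne_of_stuck hq hac hi hstuck (hL i)
    push Not at hstuck
    obtain ⟨j, rfl, k, hk, hkA⟩ := hstuck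
    have hkj : k ≠ a j := fun h => hkA (h ▸ hiA)
    by_contra hviol
    simp only [AtMostUpToOne, not_or, not_exists, not_and, not_le] at hviol
    have hmem : Function.update a j k ∈ Finset.univ.filter fun b : M → N => IsCheapest q b ∧
        (∀ i, L ≤ ownCost q b i) ∧ ∀ k ∈ A.erase (a j), AtMostUpToOne q b L k := by
      refine Finset.mem_filter.2 ⟨Finset.mem_univ _, hac.update hk, fun l => ?_, fun l hl => ?_⟩
      · by_cases h1 : l = a j
        · rw [h1, ownCost_update_owner q a hkj]
          exact (hviol.2 j rfl).le
        by_cases h2 : l = k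
        · rw [h2, ownCost_update_self q a hkj]
          linarith [haL k, hq k j]
        · rw [ownCost_update_of_ne q a h1 h2]
          exact haL l
      · obtain ⟨h1, h2⟩ := Finset.mem_erase.1 hl
        have h3 : l ≠ k := fun h => hkA (h ▸ h2)
        have h4 := haA l hl
        simp only [AtMostUpToOne, ownCost_update_of_ne q a h1 h3] at h4 ⊢
        refine h4.imp_right ?_
        rintro ⟨j', hj', hle⟩
        refine ⟨j', ?_, hle⟩
        rw [Function.update_of_ne, hj']
        rintro rfl
        exact h1 hj'.symm
    refine absurd (hamin _ hmem) (not_le.2 (Finset.card_lt_card ?_))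
    refine Finset.ssubset_iff_subset_ne.2 ⟨fun x hx => ?_, fun h => ?_⟩
    · simp only [Finset.mem_filter, Finset.mem_univ, true_and] at hx ⊢
      by_cases hxj : x = j
      · subst hxj; rfl
      · simpa [hxj] using hx
    · have : j ∈ Finset.univ.filter fun x => a x = a j := by simp
      rw [← h] at this
      simp [hkj] at this

end Rounding

section Generic

variable {N M : Type*} [Fintype N] [Fintype M]

/-- A bipartite graph with at least as many edges as vertices carries a nonzero rational edge
weighting that vanishes in total at every vertex. -/
theorem exists_balanced_weights [DecidableEq N] [DecidableEq M] {E : Finset (N × M)}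
    {A : Finset N} {J : Finset M} (hA : A.Nonempty) (hEA : ∀ e ∈ E, e.1 ∈ A) (hEJ : ∀ e ∈ E, e.2 ∈ J)
    (hcard : A.card + J.card ≤ E.card) :
    ∃ lam : N → M → ℚ, (∃ i j, lam i j ≠ 0) ∧ (∀ i j, (i, j) ∉ E → lam i j = 0) ∧
      (∀ i, ∑ j, lam i j = 0) ∧ ∀ j, ∑ i, lam i j = 0 := by
  classical
  obtain ⟨i₀, hi₀⟩ := hA
  let ext : (E → ℚ) → N → M → ℚ := fun v i j => if h : (i, j) ∈ E then v ⟨(i, j), h⟩ else 0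
  have hadd : ∀ v w i j, ext (v + w) i j = ext v i j + ext w i j := by
    intro v w i j; simp only [ext]; split_ifs <;> simp
  have hsmul : ∀ (c : ℚ) v i j, ext (c • v) i j = c * ext v i j := by
    intro c v i j; simp only [ext]; split_ifs <;> simp
  -- the condition at `i₀` follows from the others
  let Φ : (E → ℚ) →ₗ[ℚ] (A.erase i₀ ⊕ J → ℚ) :=
    { toFun := fun v => Sum.elim (fun i => ∑ j, ext v i j) (fun j => ∑ i, ext v i j)
      map_add' := by
        intro v w; ext x
        rcases x with x | x <;> simp [hadd, Finset.sum_add_distrib]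
      map_smul' := by
        intro c v; ext x
        rcases x with x | x <;> simp [hsmul, Finset.mul_sum] }
  have hpos : 0 < A.card := Finset.card_pos.2 ⟨i₀, hi₀⟩
  have hlt : Module.finrank ℚ (A.erase i₀ ⊕ J → ℚ) < Module.finrank ℚ (E → ℚ) := by
    rw [Module.finrank_fintype_fun_eq_card, Module.finrank_fintype_fun_eq_card, Fintype.card_sum,
      Fintype.card_coe, Fintype.card_coe, Fintype.card_coe, Finset.card_erase_of_mem hi₀]
    omega
  obtain ⟨v, hv, hv0⟩ := (Submodule.ne_bot_iff _).1 (LinearMap.ker_ne_bot_of_finrank_lt hlt (f := Φ))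
  have hΦ : Φ v = 0 := hv
  have hrow : ∀ i, i ≠ i₀ → ∑ j, ext v i j = 0 := by
    intro i hi
    by_cases hiA : i ∈ A
    · exact congrFun hΦ (Sum.inl ⟨i, Finset.mem_erase.2 ⟨hi, hiA⟩⟩)
    · exact Finset.sum_eq_zero fun j _ => dif_neg fun h => hiA (hEA _ h)
  have hcol : ∀ j, ∑ i, ext v i j = 0 := by
    intro j
    by_cases hj : j ∈ J
    · exact congrFun hΦ (Sum.inr ⟨j, hj⟩)
    · exact Finset.sum_eq_zero fun i _ => dif_neg fun h => hj (hEJ _ h)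
  refine ⟨ext v, ?_, fun i j h => dif_neg h, fun i => ?_, hcol⟩
  · obtain ⟨⟨⟨i, j⟩, he⟩, hne⟩ := Function.ne_iff.1 hv0
    exact ⟨i, j, by simpa [ext, he] using hne⟩
  · by_cases hi : i = i₀
    · have h1 : ∑ i, ∑ j, ext v i j = 0 := by
        rw [Finset.sum_comm]; exact Finset.sum_eq_zero fun j _ => hcol j
      rw [← Finset.add_sum_erase _ _ (Finset.mem_univ i₀),
        Finset.sum_eq_zero fun i hi => hrow i (Finset.ne_of_mem_erase hi), add_zero] at h1
      rw [hi, h1]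
    · exact hrow i hi

/-- The costs satisfy no nontrivial multiplicative relation with rational exponents. -/
def IsGeneric (C : N → M → ℝ) : Prop :=
  ∀ lam : N → M → ℚ, ∑ i, ∑ j, (lam i j : ℝ) * Real.log (C i j) = 0 → ∀ i j, lam i j = 0

/-- Without multiplicative relations between the costs, no rescaling of the agents creates a
cycle of ties. -/
theorem IsGeneric.isForest {C : N → M → ℝ} (hgen : IsGeneric C)
    (hC : ∀ i j, 0 < C i j) {w : N → ℝ} (hw : ∀ i, 0 < w i) :
    IsForest fun i j => w i * C i j := by
  classical
  intro A hA
  by_contra! hcon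
  have : Nonempty N := ⟨hA.choose⟩
  set q : N → M → ℝ := fun i j => w i * C i j with hq
  let E : Finset (N × M) :=
    Finset.univ.filter fun e => e.1 ∈ A ∧ SharedWithin q A e.1 e.2
  have hE : ∀ i j, (i, j) ∈ E ↔ i ∈ A ∧ SharedWithin q A i j := by intro i j; simp [E]
  let J : Finset M := E.image Prod.snd
  have h1 : 2 * A.card ≤ E.card := by
    rw [Finset.card_eq_sum_card_fiberwise (s := E) (t := A) (f := Prod.fst)
      fun e he => ((hE _ _).1 he).1, mul_comm, ← smul_eq_mul]
    refine Finset.card_nsmul_le_sum _ _ _ fun i hi => ?_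
    obtain ⟨j, j', hj, hj', hne⟩ := hcon i hi
    refine Finset.one_lt_card.2 ⟨(i, j), ?_, (i, j'), ?_, by simp [hne]⟩
    · simp [hE, hi, hj]
    · simp [hE, hi, hj']
  have h2 : 2 * J.card ≤ E.card := by
    rw [Finset.card_eq_sum_card_fiberwise (s := E) (t := J) (f := Prod.snd)
      fun e he => Finset.mem_image_of_mem _ he, mul_comm, ← smul_eq_mul]
    refine Finset.card_nsmul_le_sum _ _ _ fun j hj => ?_
    obtain ⟨⟨i, j'⟩, he, rfl⟩ := Finset.mem_image.1 hj
    obtain ⟨hi, hij, k, hk, hki, hkj⟩ := (hE _ _).1 he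
    refine Finset.one_lt_card.2 ⟨(i, j'), ?_, (k, j'), ?_, ?_⟩
    · exact Finset.mem_filter.2 ⟨he, rfl⟩
    · exact Finset.mem_filter.2 ⟨(hE _ _).2 ⟨hk, hkj, i, hi, hki.symm, hij⟩, rfl⟩
    · simp [hki.symm]
  obtain ⟨lam, ⟨i, j, hne⟩, hsupp, hrow, hcol⟩ := exists_balanced_weights (E := E) (J := J) hA
    (fun e he => ((hE _ _).1 he).1) (fun e he => Finset.mem_image_of_mem _ he) (by omega)
  refine hne (hgen lam ?_ i j)
  choose am ham using fun j => Finite.exists_min fun i => q i j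
  have hqpos : ∀ i j, 0 < q i j := fun i j => mul_pos (hw i) (hC i j)
  have hterm : ∀ i j, (lam i j : ℝ) * Real.log (C i j) =
      lam i j * Real.log (q (am j) j) - lam i j * Real.log (w i) := by
    intro i j
    by_cases he : (i, j) ∈ E
    · have h3 : q (am j) j = q i j :=
        le_antisymm (ham j i) (((hE _ _).1 he).2.1 (am j))
      rw [h3, hq, Real.log_mul (hw i).ne' (hC i j).ne']
      ring
    · simp [hsupp i j he]
  simp only [hterm, Finset.sum_sub_distrib]
  have h4 : ∑ i, ∑ j, (lam i j : ℝ) * Real.log (w i) = 0 :=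
    Finset.sum_eq_zero fun i _ => by
      rw [← Finset.sum_mul, ← Rat.cast_sum, hrow, Rat.cast_zero, zero_mul]
  have h5 : ∑ i, ∑ j, (lam i j : ℝ) * Real.log (q (am j) j) = 0 := by
    rw [Finset.sum_comm]
    exact Finset.sum_eq_zero fun j _ => by
      rw [← Finset.sum_mul, ← Rat.cast_sum, hcol, Rat.cast_zero, zero_mul]
  rw [h4, h5, sub_zero]

open Polynomial in
/-- Generic costs are dense: perturb the logarithms of the costs by distinct powers of a small
parameter. Each rational relation then excludes the finitely many roots of a polynomial. -/
theorem exists_isGeneric_near {C : N → M → ℝ} (hC : ∀ i j, 0 < C i j) {U : Set (N → M → ℝ)}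
    (hU : IsOpen U) (hCU : C ∈ U) : ∃ C' ∈ U, IsGeneric C' := by
  classical
  let e := Fintype.equivFin (N × M)
  let g : ℝ → N → M → ℝ := fun s i j => Real.exp (Real.log (C i j) + s ^ ((e (i, j) : ℕ) + 1))
  have hg : Continuous g := by
    refine continuous_pi fun i => continuous_pi fun j => ?_
    fun_prop
  have hg0 : g 0 = C := by
    ext i j
    simp [g, Real.exp_log (hC i j)]
  have hbad : {s | ¬ IsGeneric (g s)}.Countable := by
    let P : (N → M → ℚ) → ℝ[X] := fun lam =>
      ∑ x : N × M, Polynomial.C (lam x.1 x.2 : ℝ) *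
        (Polynomial.C (Real.log (C x.1 x.2)) + X ^ ((e x : ℕ) + 1))
    have hcoeff : ∀ lam x, (P lam).coeff ((e x : ℕ) + 1) = lam x.1 x.2 := by
      intro lam x
      simp only [P, Polynomial.finsetSum_coeff, Polynomial.coeff_C_mul, Polynomial.coeff_add,
        Polynomial.coeff_C_succ, Polynomial.coeff_X_pow, zero_add]
      rw [Finset.sum_eq_single x]
      · simp
      · intro y _ hyx
        rw [if_neg, mul_zero]
        intro h
        exact hyx (e.injective (Fin.ext (by omega)))
      · simp
    refine Set.Countable.mono (s₂ := ⋃ lam ∈ {lam : N → M → ℚ | P lam ≠ 0},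
      ((P lam).roots.toFinset : Set ℝ)) ?_
      ((Set.to_countable _).biUnion fun lam _ => (Finset.finite_toSet _).countable)
    intro s hs
    simp only [IsGeneric, Set.mem_ofPred_eq, not_forall] at hs
    obtain ⟨lam, hsum, i, j, hne⟩ := hs
    have hP : P lam ≠ 0 := by
      intro h
      have := hcoeff lam (i, j)
      rw [h, Polynomial.coeff_zero] at this
      exact hne (by exact_mod_cast this.symm)
    refine Set.mem_biUnion (x := lam) hP ?_
    simp only [Finset.mem_coe, Multiset.mem_toFinset, Polynomial.mem_roots hP,
      Polynomial.IsRoot.def, P, Polynomial.eval_finsetSum]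
    rw [Fintype.sum_prod_type, ← hsum]
    simp [g]
  have hopen : IsOpen (g ⁻¹' U) := hU.preimage hg
  have hmem : (0 : ℝ) ∈ g ⁻¹' U := by rw [Set.mem_preimage, hg0]; exact hCU
  by_contra! hcon
  refine (hopen.measure_pos MeasureTheory.volume ⟨0, hmem⟩).ne' ?_
  have hsub : g ⁻¹' U ⊆ {s | ¬ IsGeneric (g s)} := fun s hs => hcon _ hs
  exact (hbad.mono hsub).measure_zero _

end Generic

/-! ### Existence of balancing weights -/

section Existence

variable {N M : Type*}

theorem isClosed_isCheapest (a : M → N) : IsClosed {q : N → M → ℝ | IsCheapest q a} := by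
  simp only [IsCheapest, Cheapest, Set.ofPred_forall]
  exact isClosed_iInter fun j => isClosed_iInter fun k => isClosed_le (by fun_prop) (by fun_prop)

theorem exists_isCheapest [Finite N] [Nonempty N] (q : N → M → ℝ) : ∃ a, IsCheapest q a := by
  choose a ha using fun j => Finite.exists_min fun i => q i j
  exact ⟨a, ha⟩

/-- The weighted costs for the weights `exp (-A * t i)`, where `t` is a point of the simplex. -/
noncomputable def weighted (A : ℝ) (C : N → M → ℝ) (t : N → ℝ) (i : N) (j : M) : ℝ :=
  Real.exp (-A * t i) * C i j

theorem continuous_weighted (A : ℝ) :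
    Continuous fun p : (N → M → ℝ) × (N → ℝ) => weighted A p.1 p.2 := by
  unfold weighted
  fun_prop

variable [Fintype M] [DecidableEq N]

/-- Every agent pays, up to the removal of one of her chores, at most as much as any other agent
pays for her own bundle. -/
def IsBalanced (q : N → M → ℝ) (a : M → N) : Prop := ∀ i k, AtMostUpToOne q a (ownCost q a k) i

theorem AtMostUpToOne.mono {q : N → M → ℝ} {a : M → N} {L L' : ℝ} {i : N}
    (h : AtMostUpToOne q a L i) (hL : L ≤ L') : AtMostUpToOne q a L' i :=
  h.imp (fun h => h.trans hL) fun ⟨j, hj, h⟩ => ⟨j, hj, h.trans hL⟩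

theorem forcedCost_le_ownCost {q : N → M → ℝ} (hq : ∀ i j, 0 ≤ q i j) {a : M → N}
    (ha : IsCheapest q a) (i : N) : forcedCost q i ≤ ownCost q a i := by
  classical
  refine Finset.sum_le_sum fun j _ => ?_
  split_ifs with h1 h2 h2
  · exact le_rfl
  · exact absurd (h1.2 _ (ha j)) h2
  · exact hq i j
  · exact le_rfl

/-- If each agent pays least in some cheapest allocation, then some cheapest allocation is balanced:
an agent with the largest forced cost, and the allocation in which she pays least, provide the
common threshold. -/
theorem exists_isBalanced [Fintype N] [Nonempty N] {q : N → M → ℝ} (hq : ∀ i j, 0 ≤ q i j)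
    (hforest : IsForest q)
    (h : ∀ i, ∃ a, IsCheapest q a ∧ ∀ k, ownCost q a i ≤ ownCost q a k) :
    ∃ a, IsCheapest q a ∧ IsBalanced q a := by
  classical
  obtain ⟨i, hi⟩ := Finite.exists_max (forcedCost q)
  obtain ⟨a₀, ha₀, hmin⟩ := h i
  obtain ⟨a, ha, hL, ha'⟩ := exists_atMostUpToOne hq hforest hi ha₀ fun k =>
    (forcedCost_le_ownCost hq ha₀ i).trans (hmin k)
  exact ⟨a, ha, fun k l => (ha' k).mono (hL l)⟩

theorem continuous_ownCost (a : M → N) (i : N) :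
    Continuous fun q : N → M → ℝ => ownCost q a i := by
  refine continuous_finsetSum _ fun j _ => ?_
  split_ifs <;> fun_prop

theorem isClosed_isBalanced (a : M → N) : IsClosed {q : N → M → ℝ | IsBalanced q a} := by
  simp only [IsBalanced, AtMostUpToOne, Set.ofPred_forall, Set.ofPred_or, Set.ofPred_exists]
  have hown := continuous_ownCost (N := N) a
  refine isClosed_iInter fun i => isClosed_iInter fun k =>
    (isClosed_le (hown i) (hown k)).union (isClosed_iUnion_of_finite fun j => ?_)
  by_cases h : a j = i
  · simp only [h, true_and]
    exact isClosed_le ((hown i).sub (by fun_prop)) (hown k)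
  · simp [h]

variable [Fintype N]

/-- The KKM lemma applies to the sets of weights for which a given agent pays least in some cheapest
allocation: where `t i = 0`, the weight of `i` exceeds another one by so much that `i` gets no
chore. -/
theorem exists_weights_forall_least [Nonempty N] {C : N → M → ℝ} {lo hi A : ℝ} (hA : 0 ≤ A)
    (hlo₀ : 0 < lo) (hlo : ∀ i j, lo < C i j) (hhi : ∀ i j, C i j < hi)
    (hAlo : Real.exp (-A / Fintype.card N) * hi < lo) :
    ∃ t ∈ stdSimplex ℝ N, ∀ i, ∃ a, IsCheapest (weighted A C t) a ∧
      ∀ k, ownCost (weighted A C t) a i ≤ ownCost (weighted A C t) a k := by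
  classical
  have hcont : Continuous (weighted A C) :=
    (continuous_weighted A).comp (continuous_const.prodMk continuous_id)
  refine exists_mem_forall_of_facets (fun i => {t | ∃ a, IsCheapest (weighted A C t) a ∧
      ∀ k, ownCost (weighted A C t) a i ≤ ownCost (weighted A C t) a k}) ?_ ?_ ?_
  · intro i
    simp only [Set.ofPred_exists, Set.ofPred_and, Set.ofPred_forall]
    refine isClosed_iUnion_of_finite fun a => IsClosed.inter
      ((isClosed_isCheapest a).preimage hcont) (isClosed_iInter fun k => ?_)
    exact isClosed_le ((continuous_ownCost a i).comp hcont) ((continuous_ownCost a k).comp hcont)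
  · intro t _
    obtain ⟨a, ha⟩ := exists_isCheapest (weighted A C t)
    obtain ⟨i, hi⟩ := Finite.exists_min (ownCost (weighted A C t) a)
    exact ⟨i, a, ha, hi⟩
  · intro t ht i hti
    obtain ⟨a, ha⟩ := exists_isCheapest (weighted A C t)
    have hn : (0 : ℝ) < Fintype.card N := by exact_mod_cast Fintype.card_pos
    obtain ⟨k, hk⟩ : ∃ k, 1 / (Fintype.card N : ℝ) ≤ t k := by
      by_contra! hcon
      have h1 := Finset.sum_lt_sum_of_nonempty (Finset.univ_nonempty (α := N)) fun k _ => hcon k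
      rw [ht.2, Finset.sum_const, Finset.card_univ, nsmul_eq_mul, mul_one_div_cancel hn.ne'] at h1
      exact lt_irrefl _ h1
    refine ⟨a, ha, fun l => ?_⟩
    have hnone : ∀ j, a j ≠ i := by
      intro j hj
      have h1 := ha j k
      rw [hj] at h1
      simp only [weighted, hti, mul_zero, Real.exp_zero, one_mul] at h1
      have hhi₀ : 0 < hi := hlo₀.trans ((hlo i j).trans (hhi i j))
      have h2 : Real.exp (-A * t k) ≤ Real.exp (-A / Fintype.card N) := by
        refine Real.exp_le_exp.2 ?_
        rw [div_eq_mul_one_div]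
        exact mul_le_mul_of_nonpos_left hk (neg_nonpos.2 hA)
      have h3 : Real.exp (-A * t k) * C k j ≤ Real.exp (-A / Fintype.card N) * hi :=
        (mul_le_mul_of_nonneg_left (hhi k j).le (Real.exp_pos _).le).trans
          (mul_le_mul_of_nonneg_right h2 hhi₀.le)
      linarith [hlo i j]
    have h0 : ownCost (weighted A C t) a i = 0 :=
      Finset.sum_eq_zero fun j _ => if_neg (hnone j)
    rw [h0]
    refine Finset.sum_nonneg fun j _ => ?_
    split_ifs
    · exact mul_nonneg (Real.exp_pos _).le (hlo₀.trans (hlo l j)).le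
    · exact le_rfl

/-- For positive costs, a limit of generic costs provides weights and a balanced cheapest
allocation. The bounds on the costs keep the weights in a compact set. -/
theorem exists_weights_isBalanced_of_pos [Nonempty N] {C : N → M → ℝ} (hC : ∀ i j, 0 < C i j) :
    ∃ w : N → ℝ, (∀ i, 0 < w i) ∧ ∃ a, IsCheapest (fun i j => w i * C i j) a ∧
      IsBalanced (fun i j => w i * C i j) a := by
  classical
  have hbdd : ∀ f : N → M → ℝ, ∃ B, 0 < B ∧ ∀ i j, f i j < B := by
    intro f
    obtain ⟨B, hB⟩ := (Set.finite_range fun x : N × M => f x.1 x.2).bddAbove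
    refine ⟨max B 0 + 1, by positivity, fun i j => ?_⟩
    have h1 : f i j ≤ B := hB ⟨(i, j), rfl⟩
    have h2 := le_max_left B 0
    linarith
  obtain ⟨hi, hhi₀, hhi⟩ := hbdd C
  obtain ⟨b, hb₀, hb⟩ := hbdd fun i j => (C i j)⁻¹
  have hlo : ∀ i j, b⁻¹ < C i j := fun i j => (inv_lt_comm₀ (hC i j) hb₀).1 (hb i j)
  have hn : (0 : ℝ) < Fintype.card N := by exact_mod_cast Fintype.card_pos
  let A : ℝ := Fintype.card N * (hi * b)
  have hA : 0 ≤ A := by positivity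
  have hAlo : Real.exp (-A / Fintype.card N) * hi < b⁻¹ := by
    have h1 : -A / Fintype.card N = -(hi * b) := by simp only [A]; field_simp
    have h2 : hi * b < Real.exp (hi * b) := by linarith [Real.add_one_le_exp (hi * b)]
    rw [h1, Real.exp_neg, inv_mul_lt_iff₀ (Real.exp_pos _), ← div_eq_mul_inv, lt_div_iff₀ hb₀]
    exact h2
  let Z : Set ((N → M → ℝ) × stdSimplex ℝ N) :=
    {p | ∃ a, IsCheapest (weighted A p.1 p.2) a ∧ IsBalanced (weighted A p.1 p.2) a}
  have hZ : IsClosed Z := by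
    have hcont : Continuous fun p : (N → M → ℝ) × stdSimplex ℝ N => weighted A p.1 p.2 :=
      (continuous_weighted A).comp
        (continuous_fst.prodMk (continuous_subtype_val.comp continuous_snd))
    simp only [Z, Set.ofPred_exists, Set.ofPred_and]
    exact isClosed_iUnion_of_finite fun a =>
      ((isClosed_isCheapest a).preimage hcont).inter ((isClosed_isBalanced a).preimage hcont)
  have hproj : IsClosed (Prod.fst '' Z) := isClosedMap_fst_of_compactSpace _ hZ
  suffices hmem : C ∈ Prod.fst '' Z by
    obtain ⟨⟨_, t⟩, ⟨a, ha⟩, rfl⟩ := hmem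
    exact ⟨fun i => Real.exp (-A * t.1 i), fun i => Real.exp_pos _, a, ha⟩
  by_contra hnot
  have hU : IsOpen {C' : N → M → ℝ | ∀ i j, b⁻¹ < C' i j ∧ C' i j < hi} := by
    simp only [Set.ofPred_forall, Set.ofPred_and]
    exact isOpen_iInter_of_finite fun i => isOpen_iInter_of_finite fun j =>
      (isOpen_lt (by fun_prop) (by fun_prop)).inter (isOpen_lt (by fun_prop) (by fun_prop))
  obtain ⟨C', ⟨hC'U, hC'Z⟩, hgen⟩ := exists_isGeneric_near hC (hU.inter hproj.isOpen_compl)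
    ⟨fun i j => ⟨hlo i j, hhi i j⟩, hnot⟩
  have hb' : 0 < b⁻¹ := inv_pos.2 hb₀
  have hC' : ∀ i j, 0 < C' i j := fun i j => hb'.trans (hC'U i j).1
  obtain ⟨t, ht, hleast⟩ := exists_weights_forall_least hA hb' (fun i j => (hC'U i j).1)
    (fun i j => (hC'U i j).2) hAlo
  obtain ⟨a, ha⟩ := exists_isBalanced (q := weighted A C' t)
    (fun i j => (mul_pos (Real.exp_pos _) (hC' i j)).le)
    (hgen.isForest hC' fun i => Real.exp_pos (-A * t i)) hleast
  exact hC'Z ⟨(C', ⟨t, ht⟩), ⟨a, ha⟩, rfl⟩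

/-- Chores that cost nothing to somebody go to such an agent. This leaves everyone's cost for her
own bundle unchanged, so the other chores can be treated as if they were alone. -/
theorem exists_weights_isBalanced [Nonempty N] {C : N → M → ℝ} (hC : ∀ i j, 0 ≤ C i j) :
    ∃ w : N → ℝ, (∀ i, 0 < w i) ∧ ∃ a, IsCheapest (fun i j => w i * C i j) a ∧
      IsBalanced (fun i j => w i * C i j) a := by
  classical
  obtain ⟨w, hw, a', hcheap, hbal⟩ := exists_weights_isBalanced_of_pos
    (C := fun i (j : {j : M // ∀ i, 0 < C i j}) => C i j.1) fun i j => j.2 i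
  have hzero : ∀ j, ¬ (∀ i, 0 < C i j) → ∃ i, C i j = 0 := by
    intro j hj
    push Not at hj
    obtain ⟨i, hi⟩ := hj
    exact ⟨i, le_antisymm hi (hC i j)⟩
  let a : M → N := fun j => if h : ∀ i, 0 < C i j then a' ⟨j, h⟩ else (hzero j h).choose
  have ha_pos : ∀ j : {j : M // ∀ i, 0 < C i j}, a j.1 = a' j := fun j => dif_pos j.2
  have ha_zero : ∀ j, ¬ (∀ i, 0 < C i j) → C (a j) j = 0 := by
    intro j h
    simp only [a, dif_neg h]
    exact (hzero j h).choose_spec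
  have hown : ∀ i, ownCost (fun i j => w i * C i j) a i =
      ownCost (fun i (j : {j : M // ∀ i, 0 < C i j}) => w i * C i j.1) a' i := by
    intro i
    simp only [ownCost]
    rw [← Fintype.sum_subtype_add_sum_subtype (fun j => ∀ i, 0 < C i j)]
    have hz : ∑ j : {j // ¬ ∀ i, 0 < C i j}, (if a j.1 = i then w i * C i j.1 else 0) = 0 := by
      refine Finset.sum_eq_zero fun j _ => ?_
      split_ifs with h
      · rw [← h, ha_zero j.1 j.2, mul_zero]
      · rfl
    rw [hz, add_zero]
    exact Finset.sum_congr rfl fun j _ => by rw [ha_pos]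
  refine ⟨w, hw, a, fun j k => ?_, fun i k => ?_⟩
  · by_cases h : ∀ i, 0 < C i j
    · have := hcheap ⟨j, h⟩ k
      rwa [← ha_pos ⟨j, h⟩] at this
    · simp only [ha_zero j h, mul_zero]
      exact mul_nonneg (hw k).le (hC k j)
  · have := hbal i k
    simp only [AtMostUpToOne] at this ⊢
    rw [hown, hown]
    exact this.imp_right fun ⟨j, hj, hle⟩ => ⟨j.1, (ha_pos j).trans hj, hle⟩

end Existence

/-! ### From balanced cheapest allocations to EF1 and Pareto optimality -/

section Transfer

variable {N M : Type*} [Fintype M] [DecidableEq N]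

/-- The family of bundles of an allocation that is given by the owners of the chores. -/
def bundles (a : M → N) (i : N) : Finset M := Finset.univ.filter fun j => a j = i

theorem isAllocation_bundles (a : M → N) : IsAllocation (bundles a) where
  disjoint i i' h := by
    rw [Finset.disjoint_left]
    intro j hj hj'
    simp only [bundles, Finset.mem_filter, Finset.mem_univ, true_and] at hj hj'
    exact h (hj.symm.trans hj')
  cover j := ⟨a j, by simp [bundles]⟩

theorem mul_cost_bundles {c : N → Finset M → ℝ} (hc : ∀ i, IsAdditiveCost (c i)) (w : N → ℝ)
    (a : M → N) (i k : N) :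
    w i * c i (bundles a k) = ∑ j, if a j = k then w i * c i {j} else 0 := by
  rw [(hc i).additive, Finset.mul_sum, bundles, Finset.sum_filter]

variable [DecidableEq M] {c : N → Finset M → ℝ} {w : N → ℝ} {a : M → N}

/-- In a cheapest allocation each agent `i` finds the bundle of `k` at least as costly, after
weighting, as `k` does, so balancedness in the sense of own costs gives EF1. -/
theorem isEF1_bundles (hc : ∀ i, IsAdditiveCost (c i)) (hw : ∀ i, 0 < w i)
    (hcheap : IsCheapest (fun i j => w i * c i {j}) a)
    (hbal : IsBalanced (fun i j => w i * c i {j}) a) : IsEF1 c (bundles a) := by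
  intro i k henvy
  have hown : ownCost (fun i j => w i * c i {j}) a i = w i * c i (bundles a i) :=
    (mul_cost_bundles hc w a i i).symm
  have hother : ownCost (fun i j => w i * c i {j}) a k ≤ w i * c i (bundles a k) := by
    rw [mul_cost_bundles hc w a i k]
    refine Finset.sum_le_sum fun j _ => ?_
    split_ifs with h
    · have := hcheap j i
      rwa [h] at this
    · exact le_rfl
  rcases hbal i k with h | ⟨j, hj, h⟩
  · rw [hown] at h
    exact absurd (le_of_mul_le_mul_left (h.trans hother) (hw i)) (not_le.2 henvy)
  · have hjmem : j ∈ bundles a i := by simp [bundles, hj]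
    refine ⟨j, hjmem, le_of_mul_le_mul_left ?_ (hw i)⟩
    rw [(hc i).additive (bundles a i \ {j}), Finset.sdiff_singleton_eq_erase,
      Finset.sum_erase_eq_sub hjmem, ← (hc i).additive, mul_sub, ← hown]
    exact h.trans hother

/-- A cheapest allocation minimises the weighted total cost, and the weights are positive. -/
theorem isParetoOptimal_bundles [Fintype N] (hc : ∀ i, IsAdditiveCost (c i)) (hw : ∀ i, 0 < w i)
    (hcheap : IsCheapest (fun i j => w i * c i {j}) a) : IsParetoOptimal c (bundles a) := by
  rintro y hy ⟨hle, i₀, hlt⟩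
  have h1 : ∑ i, w i * c i (y i) < ∑ i, w i * c i (bundles a i) :=
    Finset.sum_lt_sum (fun i _ => mul_le_mul_of_nonneg_left (hle i) (hw i).le)
      ⟨i₀, Finset.mem_univ _, mul_lt_mul_of_pos_left hlt (hw i₀)⟩
  have h2 : ∑ i, w i * c i (bundles a i) = ∑ j, w (a j) * c (a j) {j} := by
    simp only [mul_cost_bundles hc w a]
    rw [Finset.sum_comm]
    simp
  have h3 : ∑ j, w (a j) * c (a j) {j} ≤ ∑ i, w i * c i (y i) := by
    have h4 : ∀ i, w i * c i (y i) = ∑ j, if j ∈ y i then w i * c i {j} else 0 := by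
      intro i
      rw [(hc i).additive, Finset.mul_sum, Finset.sum_ite_mem, Finset.univ_inter]
    simp only [h4]
    rw [Finset.sum_comm]
    refine Finset.sum_le_sum fun j _ => ?_
    obtain ⟨i, hi⟩ := hy.cover j
    have h5 := Finset.single_le_sum (f := fun i => if j ∈ y i then w i * c i {j} else 0)
      (fun k _ => by
        split_ifs
        · exact mul_nonneg (hw k).le ((hc k).nonneg _)
        · exact le_rfl) (Finset.mem_univ i)
    simp only [if_pos hi] at h5
    exact (hcheap j i).trans h5
  linarith

end Transfer

end Chores

theorem theorem1 (n m : ℕ) (hn : 1 ≤ n) (c : Fin n → Finset (Fin m) → ℝ)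
    (hc : ∀ i : Fin n, Chores.IsAdditiveCost (c i)) :
    ∃ x : Fin n → Finset (Fin m),
      Chores.IsAllocation x ∧ Chores.IsEF1 c x ∧ Chores.IsParetoOptimal c x := by
  have : Nonempty (Fin n) := ⟨⟨0, hn⟩⟩
  obtain ⟨w, hw, a, hcheap, hbal⟩ := Chores.exists_weights_isBalanced
    (C := fun i j => c i {j}) fun i j => (hc i).nonneg _
  exact ⟨Chores.bundles a, Chores.isAllocation_bundles a, Chores.isEF1_bundles hc hw hcheap hbal,
    Chores.isParetoOptimal_bundles hc hw hcheap⟩
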